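/- Theorem 1.1. The following six series converge absolutely and have the indicated sums: \begin{align*} \text{(S1)}\quad&\sum_{k=0}^\infty\frac{(6k^2-19k+6)\,k^3\binom{2k}{k}^3}{256^k}=-\frac1{12\pi},\\ \text{(S1$'$)}\quad&\sum_{k=0}^\infty\frac{(13608k^2+25050k+10589)\binom{2k}{k+1}^3}{256^k}=27296-\frac{84604}{\pi},\\ \text{(S2)}\quad&\sum_{k=0}^\infty\frac{(18k^2-29k+16)\,k^3\binom{2k}{k}^3}{(-512)^k}=\frac{\sqrt2}{24\pi},\\ \text{(S2$'$)}\quad&\sum_{k=0}^\infty\frac{(83592k^2+152922k+64925)\binom{2k}{k+1}^3}{(-512)^k}=625282\,\frac{\sqrt2}{\pi}-281920,\\ \text{(S3)}\quad&\sum_{k=0}^\infty\frac{(198k^2-425k+210)\,k^3\binom{2k}{k}^3}{4096^k}=-\frac1{21\pi},\\ \text{(S3$'$)}\quad&\sum_{k=0}^\infty\frac{(32473224k^2+58012446k+24235261)\binom{2k}{k+1}^3}{4096^k}=667628032-\frac{2097324016}{\pi}. \end{align*} -/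

import Mathlib

open Filter Topology Finset

/-! ### Sums of Wilf–Zeilberger pairs -/

section WilfZeilberger

variable {F G : ℕ → ℕ → ℝ} {ε β : ℕ → ℝ} {L : ℝ}

/-! Each of the six series is a multiple `α` of a classical Ramanujan series plus the telescoping
series of T(k) = q(k) `cbRatio k ^ 3` z^k, with q a polynomial and z = 64 / w, so its sum is α L -
q(0) (`hasSum_of_telescoping`). Since T(k+1)/T(k) is rational in k, this is one polynomial identity
per series.

The base series of ratio 1/4 and -1/8 are row sums of two WZ pairs: the row sum does not depend on
k, and as k → ∞ only the term n = 0 survives, with a limit given by Wallis' product. The diagonal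
staircase of the first pair gives ratio 1/64. Real `HasSum` is unconditional, hence includes
absolute convergence. -/

theorem abs_sum_range_le_mul_tsum (hβ : Summable β) (hβ0 : ∀ n, 0 ≤ β n) (hε0 : ∀ k, 0 ≤ ε k)
    (hb : ∀ n k, |G (n + 1) k| ≤ ε k * β n) (m k : ℕ) :
    |∑ n ∈ range m, G (n + 1) k| ≤ ε k * ∑' n, β n :=
  calc |∑ n ∈ range m, G (n + 1) k| ≤ ∑ n ∈ range m, |G (n + 1) k| := abs_sum_le_sum_abs _ _
    _ ≤ ∑ n ∈ range m, ε k * β n := sum_le_sum fun n _ => hb n k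
    _ = ε k * ∑ n ∈ range m, β n := (mul_sum _ _ _).symm
    _ ≤ ε k * ∑' n, β n :=
      mul_le_mul_of_nonneg_left (hβ.sum_le_tsum _ fun n _ => hβ0 n) (hε0 k)

/-- If the terms with positive first index are dominated by `ε k * β n`, the sums along the
diagonal staircase of a WZ pair tend to the limit of the initial terms `G 0 k`. -/
theorem tendsto_staircase_of_wz
    (hwz : ∀ n k, F (n + 1) k - F n k = G n (k + 1) - G n k) (hF0 : ∀ k, F 0 k = 0)
    (hβ : Summable β) (hβ0 : ∀ n, 0 ≤ β n) (hε0 : ∀ k, 0 ≤ ε k)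
    (hb : ∀ n k, |G (n + 1) k| ≤ ε k * β n)
    (hε : Tendsto ε atTop (𝓝 0)) (hL : Tendsto (G 0) atTop (𝓝 L)) :
    Tendsto (fun m => ∑ n ∈ range m, (G n n + F (n + 1) n)) atTop (𝓝 L) := by
  -- Discrete Green's theorem: the staircase path may be replaced by the column k = m, as the edge n
  -- = 0 contributes nothing (F vanishes there).
  have hsum : ∀ m, ∑ n ∈ range m, (G n n + F (n + 1) n) = ∑ n ∈ range m, G n m := by
    intro m
    induction m with
    | zero => simp
    | succ m ih =>
      have h1 : ∑ n ∈ range m, G n (m + 1) - ∑ n ∈ range m, G n m = F m m := by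
        rw [← sum_sub_distrib, sum_congr rfl fun n _ => (hwz n m).symm,
          sum_range_sub (fun n => F n m), hF0, sub_zero]
      rw [sum_range_succ, ih, sum_range_succ]
      linarith [hwz m m]
  rw [← tendsto_add_atTop_iff_nat 1]
  have h0 : Tendsto (fun m => ∑ n ∈ range m, G (n + 1) (m + 1)) atTop (𝓝 0) := by
    refine squeeze_zero_norm (fun m => abs_sum_range_le_mul_tsum hβ hβ0 hε0 hb m (m + 1)) ?_
    simpa using ((tendsto_add_atTop_iff_nat 1).2 hε).mul_const (∑' n, β n)
  have h := h0.add ((tendsto_add_atTop_iff_nat 1).2 hL)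
  rw [zero_add] at h
  refine h.congr fun m => ?_
  rw [hsum, sum_range_succ']

theorem summable_of_wz_bound (hβ : Summable β) (hb : ∀ n k, |G (n + 1) k| ≤ ε k * β n) (k : ℕ) :
    Summable fun n => G n k :=
  (summable_nat_add_iff 1).1 <|
    Summable.of_norm_bounded (hβ.mul_left (ε k)) fun n => hb n k

/-- If the terms with positive first index are dominated by `ε k * β n`, the row sum of a WZ
pair is the limit of the initial terms `G 0 k`. -/
theorem hasSum_of_wz {C : ℝ}
    (hwz : ∀ n k, F (n + 1) k - F n k = G n (k + 1) - G n k) (hF0 : ∀ k, F 0 k = 0)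
    (hFG : ∀ n k, |F n k| ≤ C * |G n k|)
    (hβ : Summable β) (hb : ∀ n k, |G (n + 1) k| ≤ ε k * β n)
    (hε : Tendsto ε atTop (𝓝 0)) (hL : Tendsto (G 0) atTop (𝓝 L)) :
    HasSum (fun n => G n 0) L := by
  have hs := summable_of_wz_bound hβ hb
  have hstep : ∀ k, ∑' n, G n (k + 1) = ∑' n, G n k := by
    intro k
    have hF : Tendsto (fun n => F n k) atTop (𝓝 0) := by
      refine squeeze_zero_norm (fun n => hFG n k) ?_
      simpa using ((hs k).tendsto_atTop_zero.abs).const_mul C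
    have h1 := ((hs (k + 1)).hasSum.sub (hs k).hasSum).tendsto_sum_nat
    have h2 : ∀ m, ∑ n ∈ range m, (G n (k + 1) - G n k) = F m k := by
      intro m
      rw [sum_congr rfl fun n _ => (hwz n k).symm, sum_range_sub (fun n => F n k), hF0, sub_zero]
    simp only [h2] at h1
    exact sub_eq_zero.1 (tendsto_nhds_unique h1 hF)
  have hconst : ∀ k, ∑' n, G n k = ∑' n, G n 0 := by
    intro k
    induction k with
    | zero => rfl
    | succ k ih => rw [hstep, ih]
  have htail : Tendsto (fun k => ∑' n, G (n + 1) k) atTop (𝓝 0) := by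
    refine squeeze_zero_norm (a := fun k => ε k * ∑' n, β n) (fun k => ?_) ?_
    · rw [← tsum_mul_left]
      exact tsum_of_norm_bounded (hβ.mul_left (ε k)).hasSum fun n => hb n k
    · simpa using hε.mul_const (∑' n, β n)
  have hlim := hL.add htail
  rw [add_zero] at hlim
  have hcongr : ∀ k, G 0 k + ∑' n, G (n + 1) k = ∑' n, G n 0 := fun k => by
    rw [← hconst k, (hs k).tsum_eq_zero_add]
  simp only [hcongr] at hlim
  rw [← tendsto_nhds_unique tendsto_const_nhds hlim]
  exact (hs 0).hasSum

end WilfZeilberger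

/-! ### Normalized central binomial coefficients -/

/-- The normalized central binomial coefficient `(2n choose n) / 4 ^ n`. -/
noncomputable def cbRatio (n : ℕ) : ℝ := n.centralBinom / 4 ^ n

@[simp] theorem cbRatio_zero : cbRatio 0 = 1 := by simp [cbRatio]

theorem cbRatio_succ (n : ℕ) : cbRatio (n + 1) = cbRatio n * (2 * n + 1) / (2 * (n + 1)) := by
  have h : ((n : ℝ) + 1) * (n + 1).centralBinom = 2 * (2 * n + 1) * n.centralBinom := by
    exact_mod_cast n.succ_mul_centralBinom_succ
  rw [cbRatio, cbRatio, pow_succ, eq_div_iff (by positivity)]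
  field_simp
  linear_combination 2 * h

theorem cbRatio_pos (n : ℕ) : 0 < cbRatio n :=
  div_pos (by exact_mod_cast n.centralBinom_pos) (by positivity)

theorem cbRatio_le_one (n : ℕ) : cbRatio n ≤ 1 :=
  div_le_one_of_le₀ (by exact_mod_cast n.centralBinom_le_four_pow) (by positivity)

theorem cbRatio_sq_mul_wallis (n : ℕ) : cbRatio n ^ 2 * (2 * n + 1) * Real.Wallis.W n = 1 := by
  induction n with
  | zero => simp [Real.Wallis.W]
  | succ n ih =>
    refine Eq.trans ?_ ih
    rw [Real.Wallis.W_succ, cbRatio_succ]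
    push_cast
    field_simp
    ring

theorem tendsto_cbRatio_sq_mul : Tendsto (fun n : ℕ => cbRatio n ^ 2 * (2 * n + 1)) atTop
    (𝓝 (2 / Real.pi)) := by
  have h := Real.Wallis.tendsto_W_nhds_pi_div_two.inv₀ (by positivity)
  rw [inv_div] at h
  exact h.congr fun n => (eq_inv_of_mul_eq_one_left (cbRatio_sq_mul_wallis n)).symm

theorem tendsto_cbRatio_sq : Tendsto (fun n : ℕ => cbRatio n ^ 2) atTop (𝓝 0) := by
  have h1 : Tendsto (fun n : ℕ => (2 * (n : ℝ) + 1)) atTop atTop :=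
    tendsto_atTop_add_const_right _ _ (tendsto_natCast_atTop_atTop.const_mul_atTop two_pos)
  have h := tendsto_cbRatio_sq_mul.mul h1.inv_tendsto_atTop
  rw [mul_zero] at h
  refine h.congr fun n => ?_
  simp only [Pi.inv_apply]
  field_simp

theorem tendsto_cbRatio : Tendsto cbRatio atTop (𝓝 0) := by
  have h := tendsto_cbRatio_sq.sqrt
  rw [Real.sqrt_zero] at h
  exact h.congr fun n => Real.sqrt_sq (cbRatio_pos n).le

theorem tendsto_cbRatio_sq_mul_four : Tendsto (fun n : ℕ => cbRatio n ^ 2 * (4 * n + 1)) atTop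
    (𝓝 (4 / Real.pi)) := by
  have h := (tendsto_cbRatio_sq_mul.const_mul 2).sub tendsto_cbRatio_sq
  rw [sub_zero, show 2 * (2 / Real.pi) = 4 / Real.pi by ring] at h
  exact h.congr fun n => by ring

theorem tendsto_cbRatio_two_mul_sq_mul :
    Tendsto (fun n : ℕ => cbRatio (2 * n) ^ 2 * (4 * n + 1)) atTop (𝓝 (2 / Real.pi)) := by
  have h := tendsto_cbRatio_sq_mul.comp (tendsto_id.const_mul_atTop' (two_pos : (0 : ℕ) < 2))
  refine h.congr fun n => ?_
  simp only [Function.comp, id]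
  push_cast
  ring

/-- The square of this sequence is the product of the two preceding ones; this is where √2 enters.
-/
theorem tendsto_cbRatio_two_mul_mul_cbRatio :
    Tendsto (fun n : ℕ => (4 * n + 1) * (cbRatio (2 * n) * cbRatio n)) atTop
      (𝓝 (2 * √2 / Real.pi)) := by
  have h := (tendsto_cbRatio_two_mul_sq_mul.mul tendsto_cbRatio_sq_mul_four).sqrt
  have e : √(2 / Real.pi * (4 / Real.pi)) = 2 * √2 / Real.pi := by
    rw [show 2 / Real.pi * (4 / Real.pi) = (2 / Real.pi) ^ 2 * 2 by ring,
      Real.sqrt_mul (by positivity), Real.sqrt_sq (by positivity)]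
    ring
  rw [e] at h
  refine h.congr fun n => ?_
  have := cbRatio_pos n
  have := cbRatio_pos (2 * n)
  rw [← Real.sqrt_sq (show 0 ≤ (4 * n + 1) * (cbRatio (2 * n) * cbRatio n) by positivity)]
  congr 1
  ring

/-! ### The WZ pair of ratio `1 / 4` -/

/-- The reciprocal binomial coefficient `n! k! / (n + k)!`. -/
noncomputable def invChoose (n k : ℕ) : ℝ :=
  n.factorial * k.factorial / (n + k).factorial

theorem invChoose_pos (n k : ℕ) : 0 < invChoose n k := by
  unfold invChoose
  positivity

@[simp] theorem invChoose_zero_left (k : ℕ) : invChoose 0 k = 1 := by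
  simp [invChoose, Nat.factorial_ne_zero]

@[simp] theorem invChoose_zero_right (n : ℕ) : invChoose n 0 = 1 := by
  simp [invChoose, Nat.factorial_ne_zero]

theorem invChoose_succ_left (n k : ℕ) :
    invChoose (n + 1) k = invChoose n k * (n + 1) / (n + k + 1) := by
  rw [invChoose, invChoose, Nat.add_right_comm, Nat.factorial_succ, Nat.factorial_succ]
  push_cast
  field_simp

theorem invChoose_succ_right (n k : ℕ) :
    invChoose n (k + 1) = invChoose n k * (k + 1) / (n + k + 1) := by
  rw [invChoose, invChoose, ← Nat.add_assoc, Nat.factorial_succ, Nat.factorial_succ]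
  push_cast
  field_simp

/-- Nonincreasing in n, with equality at n = 0. The factor 1/(k+1) absorbs the linear growth of G in
k. -/
theorem invChoose_succ_left_le (n k : ℕ) : invChoose (n + 1) k ≤ 1 / (k + 1) := by
  induction n with
  | zero => rw [invChoose_succ_left]; simp
  | succ n ih =>
    rw [invChoose_succ_left]
    refine le_trans (div_le_of_le_mul₀ (by positivity) (invChoose_pos _ _).le ?_) ih
    have := invChoose_pos (n + 1) k
    gcongr
    push_cast
    linarith [(Nat.cast_nonneg k : (0 : ℝ) ≤ k)]

/-- The hypergeometric kernel of the WZ pair of ratio `1 / 4`. -/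
noncomputable def wzFour (n k : ℕ) : ℝ :=
  cbRatio k ^ 2 * cbRatio n ^ 3 * invChoose n k ^ 2 * (1 / 4) ^ n

theorem wzFour_nonneg (n k : ℕ) : 0 ≤ wzFour n k := by
  have := cbRatio_pos k
  have := cbRatio_pos n
  have := invChoose_pos n k
  unfold wzFour
  positivity

/-- The WZ equation for F = 8n `wzFour` and G = (6n+4k+1) `wzFour`; dividing by the kernel leaves a
rational identity. -/
theorem wzFour_identity (n k : ℕ) :
    8 * ((n + 1 : ℕ) : ℝ) * wzFour (n + 1) k - 8 * n * wzFour n k =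
      (6 * n + 4 * (k + 1 : ℕ) + 1) * wzFour n (k + 1) - (6 * n + 4 * k + 1) * wzFour n k := by
  simp only [wzFour, cbRatio_succ, invChoose_succ_left, invChoose_succ_right, pow_succ]
  push_cast
  field_simp
  ring

theorem six_mul_add_four_mul_le (n k : ℕ) (c : ℝ) (hc : 4 ≤ 6 * n + c) :
    (6 * n + 4 * k + c) * (1 / (k + 1)) ≤ 6 * n + c := by
  rw [mul_one_div]
  refine div_le_of_le_mul₀ (by positivity) (by linarith) ?_
  nlinarith [(Nat.cast_nonneg k : (0 : ℝ) ≤ k)]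

theorem summable_linear_mul_geometric {r : ℝ} (hr : |r| < 1) (c d : ℝ) :
    Summable fun n : ℕ => (c * n + d) * r ^ n := by
  have h1 : Summable fun n : ℕ => (n : ℝ) * r ^ n := by
    simpa using summable_pow_mul_geometric_of_norm_lt_one 1 hr
  have h2 : Summable fun n : ℕ => r ^ n := summable_geometric_of_abs_lt_one hr
  exact ((h1.mul_left c).add (h2.mul_left d)).congr fun n => by ring

theorem wzFour_bound (n k : ℕ) :
    |(6 * ((n + 1 : ℕ) : ℝ) + 4 * k + 1) * wzFour (n + 1) k| ≤
      cbRatio k * ((6 * n + 7) * (1 / 4) ^ n) := by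
  have h0 := wzFour_nonneg (n + 1) k
  rw [abs_of_nonneg (by positivity)]
  have ha := cbRatio_pos k
  have ha1 := cbRatio_le_one k
  have hn := cbRatio_pos (n + 1)
  have hn1 := cbRatio_le_one (n + 1)
  have hi := invChoose_pos (n + 1) k
  have hi1 := invChoose_succ_left_le n k
  have hk : (1 : ℝ) / (k + 1) ≤ 1 := by
    rw [div_le_one (by positivity)]
    linarith [(Nat.cast_nonneg k : (0 : ℝ) ≤ k)]
  have hp : (1 / 4 : ℝ) ^ (n + 1) ≤ (1 / 4) ^ n :=
    pow_le_pow_of_le_one (by norm_num) (by norm_num) n.le_succ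
  have key : wzFour (n + 1) k ≤ cbRatio k * 1 * (1 / (k + 1)) * (1 / 4) ^ n := by
    unfold wzFour
    gcongr
    · nlinarith
    · exact pow_le_one₀ hn.le hn1
    · nlinarith
  calc _ ≤ (6 * ((n + 1 : ℕ) : ℝ) + 4 * k + 1) *
          (cbRatio k * 1 * (1 / (k + 1)) * (1 / 4) ^ n) := by gcongr
    _ = cbRatio k * (((6 * n + 4 * k + 7) * (1 / (k + 1))) * (1 / 4) ^ n) := by push_cast; ring
    _ ≤ _ := by
      have := six_mul_add_four_mul_le n k 7 (by linarith [(Nat.cast_nonneg n : (0 : ℝ) ≤ n)])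
      gcongr

theorem tendsto_wzFour_zero :
    Tendsto (fun k : ℕ => (6 * ((0 : ℕ) : ℝ) + 4 * k + 1) * wzFour 0 k) atTop
      (𝓝 (4 / Real.pi)) :=
  tendsto_cbRatio_sq_mul_four.congr fun k => by simp [wzFour]; ring

/-- Ramanujan's series for `1 / π` of ratio `1 / 4`. -/
theorem hasSum_ramanujan_four :
    HasSum (fun n : ℕ => (6 * n + 1) * (cbRatio n ^ 3 * (1 / 4) ^ n)) (4 / Real.pi) := by
  have h := hasSum_of_wz (C := 2) (F := fun n k => 8 * (n : ℝ) * wzFour n k)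
    (G := fun n k => (6 * (n : ℝ) + 4 * k + 1) * wzFour n k) wzFour_identity (by simp)
    (fun n k => by
      have := wzFour_nonneg n k
      rw [abs_of_nonneg (by positivity), abs_of_nonneg (by positivity), ← mul_assoc]
      refine mul_le_mul_of_nonneg_right ?_ this
      linarith [(Nat.cast_nonneg k : (0 : ℝ) ≤ k), (Nat.cast_nonneg n : (0 : ℝ) ≤ n)])
    (summable_linear_mul_geometric (by norm_num [abs_of_pos]) 6 7)
    wzFour_bound tendsto_cbRatio tendsto_wzFour_zero
  simpa [wzFour] using h

/-- Ramanujan's series for `1 / π` of ratio `1 / 64`. -/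
theorem hasSum_ramanujan_sixtyFour :
    HasSum (fun n : ℕ => (42 * n + 5) * (cbRatio n ^ 3 * (1 / 64) ^ n)) (16 / Real.pi) := by
  have h := tendsto_staircase_of_wz (F := fun n k => 8 * (n : ℝ) * wzFour n k)
    (G := fun n k => (6 * (n : ℝ) + 4 * k + 1) * wzFour n k) wzFour_identity (by simp)
    (summable_linear_mul_geometric (by norm_num [abs_of_pos]) 6 7) (fun n => by positivity)
    (fun k => (cbRatio_pos k).le) wzFour_bound tendsto_cbRatio tendsto_wzFour_zero
  -- This collapses the diagonal kernel to `cbRatio n ^ 3 * (1 / 64) ^ n`.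
  have hcb : ∀ n : ℕ, invChoose n n = (1 / 4) ^ n / cbRatio n := by
    intro n
    induction n with
    | zero => simp
    | succ n ih =>
      have := cbRatio_pos n
      rw [invChoose_succ_left, invChoose_succ_right, ih, cbRatio_succ, pow_succ]
      push_cast
      field_simp
      ring
  have hterm : ∀ n : ℕ, 4 * ((6 * (n : ℝ) + 4 * n + 1) * wzFour n n +
      8 * ((n + 1 : ℕ) : ℝ) * wzFour (n + 1) n) =
      (42 * n + 5) * (cbRatio n ^ 3 * (1 / 64) ^ n) := by
    intro n
    have := cbRatio_pos n
    have e : ((1 : ℝ) / 64) ^ n = ((1 / 4) ^ n) ^ 3 := by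
      rw [← pow_mul, mul_comm, pow_mul]; norm_num
    simp only [wzFour, cbRatio_succ, invChoose_succ_left, hcb, pow_succ (1 / 4 : ℝ) n, e]
    push_cast
    field_simp
    ring
  -- The staircase only gives convergence of partial sums; positivity upgrades it.
  rw [hasSum_iff_tendsto_nat_of_nonneg fun n => by have := cbRatio_pos n; positivity]
  have h4 := h.const_mul 4
  rw [show 4 * (4 / Real.pi) = 16 / Real.pi by ring] at h4
  refine h4.congr fun m => ?_
  rw [mul_sum]
  exact sum_congr rfl fun n _ => hterm n

/-! ### The WZ pair of ratio `-1 / 8` -/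

/-- The quotient `n! (n + 2k)! / ((n + k)! ^ 2 4 ^ k)`. -/
noncomputable def factorialQuot (n k : ℕ) : ℝ :=
  n.factorial * (n + 2 * k).factorial / ((n + k).factorial ^ 2 * 4 ^ k)

theorem factorialQuot_pos (n k : ℕ) : 0 < factorialQuot n k := by
  unfold factorialQuot
  positivity

theorem factorialQuot_succ_left (n k : ℕ) : factorialQuot (n + 1) k =
    factorialQuot n k * ((n + 1) * (n + 2 * k + 1)) / (n + k + 1) ^ 2 := by
  rw [factorialQuot, factorialQuot, Nat.add_right_comm, Nat.add_right_comm n 1 k,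
    Nat.factorial_succ, Nat.factorial_succ, Nat.factorial_succ]
  push_cast
  field_simp

theorem factorialQuot_succ_right (n k : ℕ) : factorialQuot n (k + 1) =
    factorialQuot n k * ((n + 2 * k + 1) * (n + 2 * k + 2)) / (4 * (n + k + 1) ^ 2) := by
  rw [factorialQuot, factorialQuot, show n + 2 * (k + 1) = n + 2 * k + 1 + 1 by ring,
    ← Nat.add_assoc, Nat.factorial_succ, Nat.factorial_succ, Nat.factorial_succ, pow_succ]
  push_cast
  field_simp
  ring

@[simp] theorem factorialQuot_zero_right (n : ℕ) : factorialQuot n 0 = 1 := by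
  have := Nat.factorial_ne_zero n
  simp [factorialQuot]
  field_simp

theorem factorialQuot_zero_left (k : ℕ) : factorialQuot 0 k = cbRatio k := by
  induction k with
  | zero => simp
  | succ k ih =>
    rw [factorialQuot_succ_right, ih, cbRatio_succ]
    push_cast
    field_simp
    ring

/-- Nonincreasing in n, since (n+1)(n+2k+1) ≤ (n+k+1)² by AM-GM; the case n = 0 supplies the bound.
-/
theorem factorialQuot_succ_left_le (n k : ℕ) :
    factorialQuot (n + 1) k ≤ 2 * cbRatio k * (1 / (k + 1)) := by
  have ha := cbRatio_pos k
  induction n with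
  | zero =>
    rw [factorialQuot_succ_left, factorialQuot_zero_left, div_le_iff₀ (by positivity)]
    push_cast
    field_simp
    nlinarith [(Nat.cast_nonneg k : (0 : ℝ) ≤ k)]
  | succ n ih =>
    rw [factorialQuot_succ_left]
    refine le_trans (div_le_of_le_mul₀ (by positivity) (factorialQuot_pos _ _).le ?_) ih
    have := factorialQuot_pos (n + 1) k
    gcongr
    push_cast
    nlinarith [(Nat.cast_nonneg k : (0 : ℝ) ≤ k)]

/-- The hypergeometric kernel of the WZ pair of ratio `-1 / 8`. -/
noncomputable def wzEight (n k : ℕ) : ℝ :=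
  cbRatio n ^ 2 * cbRatio (n + 2 * k) * factorialQuot n k * (-1 / 8) ^ n

theorem wzEight_identity (n k : ℕ) :
    4 * ((n + 1 : ℕ) : ℝ) * wzEight (n + 1) k - 4 * n * wzEight n k =
      (6 * n + 4 * (k + 1 : ℕ) + 1) * wzEight n (k + 1) - (6 * n + 4 * k + 1) * wzEight n k := by
  simp only [wzEight, show n + 2 * (k + 1) = n + 2 * k + 1 + 1 by ring,
    show n + 1 + 2 * k = n + 2 * k + 1 by ring, cbRatio_succ, factorialQuot_succ_left,
    factorialQuot_succ_right, pow_succ]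
  push_cast
  field_simp
  ring

theorem wzEight_bound (n k : ℕ) :
    |(6 * ((n + 1 : ℕ) : ℝ) + 4 * k + 1) * wzEight (n + 1) k| ≤
      cbRatio k * ((12 * n + 14) * (1 / 8) ^ n) := by
  have ha := cbRatio_pos k
  have hn := cbRatio_pos (n + 1)
  have hn1 := cbRatio_le_one (n + 1)
  have hm := cbRatio_pos (n + 1 + 2 * k)
  have hm1 := cbRatio_le_one (n + 1 + 2 * k)
  have hi := factorialQuot_pos (n + 1) k
  have hi1 := factorialQuot_succ_left_le n k
  have hp : (1 / 8 : ℝ) ^ (n + 1) ≤ (1 / 8) ^ n :=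
    pow_le_pow_of_le_one (by norm_num) (by norm_num) n.le_succ
  have key : |wzEight (n + 1) k| ≤ 1 * 1 * (2 * cbRatio k * (1 / (k + 1))) * (1 / 8) ^ n := by
    unfold wzEight
    rw [abs_mul, abs_pow, abs_of_pos (by positivity),
      show |(-1 / 8 : ℝ)| = 1 / 8 by norm_num [abs_div]]
    gcongr
    · exact pow_le_one₀ hn.le hn1
  rw [abs_mul, abs_of_nonneg (a := 6 * ((n + 1 : ℕ) : ℝ) + 4 * k + 1) (by positivity)]
  calc _ ≤ (6 * ((n + 1 : ℕ) : ℝ) + 4 * k + 1) *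
          (1 * 1 * (2 * cbRatio k * (1 / (k + 1))) * (1 / 8) ^ n) := by gcongr
    _ = cbRatio k * ((2 * ((6 * n + 4 * k + 7) * (1 / (k + 1)))) * (1 / 8) ^ n) := by
      push_cast; ring
    _ ≤ cbRatio k * ((2 * (6 * n + 7)) * (1 / 8) ^ n) := by
      have := six_mul_add_four_mul_le n k 7 (by linarith [(Nat.cast_nonneg n : (0 : ℝ) ≤ n)])
      gcongr
    _ = _ := by ring

/-- Ramanujan's alternating series for `√2 / π` of ratio `-1 / 8`. -/
theorem hasSum_ramanujan_eight :
    HasSum (fun n : ℕ => (6 * n + 1) * (cbRatio n ^ 3 * (-1 / 8) ^ n)) (2 * √2 / Real.pi) := by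
  have h := hasSum_of_wz (C := 1) (F := fun n k => 4 * (n : ℝ) * wzEight n k)
    (G := fun n k => (6 * (n : ℝ) + 4 * k + 1) * wzEight n k) wzEight_identity (by simp)
    (fun n k => by
      rw [one_mul, abs_mul (4 * (n : ℝ)), abs_mul (6 * (n : ℝ) + 4 * k + 1),
        abs_of_nonneg (a := 4 * (n : ℝ)) (by positivity),
        abs_of_nonneg (a := 6 * (n : ℝ) + 4 * k + 1) (by positivity)]
      refine mul_le_mul_of_nonneg_right ?_ (abs_nonneg _)
      linarith [(Nat.cast_nonneg k : (0 : ℝ) ≤ k), (Nat.cast_nonneg n : (0 : ℝ) ≤ n)])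
    (summable_linear_mul_geometric (by norm_num [abs_of_pos]) 12 14)
    wzEight_bound tendsto_cbRatio
    (tendsto_cbRatio_two_mul_mul_cbRatio.congr fun k => by
      simp [wzEight, factorialQuot_zero_left])
  refine h.congr_fun fun n => ?_
  simp only [wzEight, mul_zero, add_zero, factorialQuot_zero_right, Nat.cast_zero]
  ring

/-! ### Telescoping reductions -/

open Polynomial in
theorem summable_eval_mul_cbRatio_pow {z : ℝ} (hz : |z| < 1) (q : ℝ[X]) :
    Summable fun k : ℕ => q.eval (k : ℝ) * (cbRatio k ^ 3 * z ^ k) := by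
  have hle : ∀ k, |cbRatio k ^ 3| ≤ 1 := fun k => by
    rw [abs_of_pos (pow_pos (cbRatio_pos k) 3)]
    exact pow_le_one₀ (cbRatio_pos k).le (cbRatio_le_one k)
  induction q using Polynomial.induction_on' with
  | add p q hp hq => exact (hp.add hq).congr fun k => by rw [eval_add]; ring
  | monomial m c =>
    have h : Summable fun k : ℕ => ‖c * ((k : ℝ) ^ m * z ^ k)‖ :=
      ((summable_pow_mul_geometric_of_norm_lt_one m hz).mul_left c).norm
    refine h.of_norm_bounded fun k => ?_
    rw [eval_monomial, show c * (k : ℝ) ^ m * (cbRatio k ^ 3 * z ^ k) =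
      c * ((k : ℝ) ^ m * z ^ k) * cbRatio k ^ 3 by ring, norm_mul]
    exact mul_le_of_le_one_right (norm_nonneg _) (hle k)

open Polynomial in
/-- A term that differs from a multiple of a known series by a polynomial telescoping
difference is summable, with the sum read off from the initial value of the polynomial. -/
theorem hasSum_of_telescoping {z α c d L : ℝ} (hz : |z| < 1) {f : ℕ → ℝ} (q : ℝ[X])
    (hbase : HasSum (fun k : ℕ => (c * k + d) * (cbRatio k ^ 3 * z ^ k)) L)
    (hf : ∀ k : ℕ, f k * (8 * (k + 1) ^ 3) =
      (8 * (k + 1) ^ 3 * (α * (c * k + d) - q.eval (k : ℝ)) +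
        q.eval ((k : ℝ) + 1) * (2 * k + 1) ^ 3 * z) * (cbRatio k ^ 3 * z ^ k)) :
    HasSum f (α * L - q.eval 0) := by
  have hT := summable_eval_mul_cbRatio_pow hz q
  -- The shifted sum of T minus the sum of T is -T(0) = -q(0).
  have h1 := (hasSum_nat_add_iff' 1).2 hT.hasSum
  have h2 := (hbase.mul_left α).add (h1.sub hT.hasSum)
  rw [sum_range_one, Nat.cast_zero, cbRatio_zero, pow_zero, sub_sub_cancel_left, one_pow, mul_one,
    mul_one, ← sub_eq_add_neg] at h2
  refine h2.congr_fun fun k => ?_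
  have h8 : (8 * ((k : ℝ) + 1) ^ 3) ≠ 0 := by positivity
  apply mul_right_cancel₀ h8
  rw [hf, cbRatio_succ, pow_succ z]
  push_cast
  field_simp
  ring

theorem choose_cube_div (k : ℕ) {w z : ℝ} (hw : w * z = 64) :
    ((2 * k).choose k : ℝ) ^ 3 / w ^ k = cbRatio k ^ 3 * z ^ k := by
  have hz : z ≠ 0 := by rintro rfl; norm_num at hw
  have h : w ^ k * z ^ k = (4 ^ k) ^ 3 := by
    rw [← mul_pow, hw, ← pow_mul, mul_comm, pow_mul]; norm_num
  have hw0 : w ≠ 0 := by rintro rfl; norm_num at hw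
  rw [cbRatio, Nat.centralBinom_eq_two_mul_choose, div_pow, ← h]
  field_simp


theorem choose_succ_cube_div (k : ℕ) {w z : ℝ} (hw : w * z = 64) :
    ((2 * k).choose (k + 1) : ℝ) ^ 3 / w ^ k * (k + 1) ^ 3 =
      k ^ 3 * (cbRatio k ^ 3 * z ^ k) := by
  have h : ((2 * k).choose (k + 1) : ℝ) * (k + 1) = (2 * k).choose k * k := by
    have := Nat.choose_succ_right_eq (2 * k) k
    rw [show 2 * k - k = k by omega] at this
    exact_mod_cast this
  rw [← choose_cube_div k hw, div_mul_eq_mul_div, ← mul_pow, h]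
  ring

open Polynomial in
/-- Telescoping reduction of a series over `(2k choose k) ^ 3 / w ^ k`. -/
theorem hasSum_choose_cube {w z α c d L S : ℝ} (hz : |z| < 1) (hw : w * z = 64) (p : ℝ → ℝ)
    (q : ℝ[X]) (hbase : HasSum (fun k : ℕ => (c * k + d) * (cbRatio k ^ 3 * z ^ k)) L)
    (hp : ∀ x : ℝ, p x * (8 * (x + 1) ^ 3) =
      8 * (x + 1) ^ 3 * (α * (c * x + d) - q.eval x) + q.eval (x + 1) * (2 * x + 1) ^ 3 * z)
    (hS : α * L - q.eval 0 = S) :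
    HasSum (fun k : ℕ => p k * ((2 * k).choose k : ℝ) ^ 3 / w ^ k) S := by
  rw [← hS]
  refine hasSum_of_telescoping hz q hbase fun k => ?_
  rw [mul_div_assoc, choose_cube_div k hw, ← hp]
  ring

open Polynomial in
/-- Telescoping reduction of a series over `(2k choose k + 1) ^ 3 / w ^ k`. -/
theorem hasSum_choose_succ_cube {w z α c d L S : ℝ} (hz : |z| < 1) (hw : w * z = 64) (p : ℝ → ℝ)
    (q : ℝ[X]) (hbase : HasSum (fun k : ℕ => (c * k + d) * (cbRatio k ^ 3 * z ^ k)) L)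
    (hp : ∀ x : ℝ, 8 * p x * x ^ 3 =
      8 * (x + 1) ^ 3 * (α * (c * x + d) - q.eval x) + q.eval (x + 1) * (2 * x + 1) ^ 3 * z)
    (hS : α * L - q.eval 0 = S) :
    HasSum (fun k : ℕ => p k * ((2 * k).choose (k + 1) : ℝ) ^ 3 / w ^ k) S := by
  rw [← hS]
  refine hasSum_of_telescoping hz q hbase fun k => ?_
  rw [mul_div_assoc, ← hp]
  linear_combination 8 * p k * choose_succ_cube_div k hw

open Polynomial in
theorem theorem1p1 :
    HasSum (fun k : ℕ =>
      (6 * (k : ℝ) ^ 2 - 19 * (k : ℝ) + 6) * (k : ℝ) ^ 3 * ((2 * k).choose k : ℝ) ^ 3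
        / (256 : ℝ) ^ k)
      (-(1 / (12 * Real.pi))) ∧
    HasSum (fun k : ℕ =>
      (13608 * (k : ℝ) ^ 2 + 25050 * (k : ℝ) + 10589) * ((2 * k).choose (k + 1) : ℝ) ^ 3
        / (256 : ℝ) ^ k)
      (27296 - 84604 / Real.pi) ∧
    HasSum (fun k : ℕ =>
      (18 * (k : ℝ) ^ 2 - 29 * (k : ℝ) + 16) * (k : ℝ) ^ 3 * ((2 * k).choose k : ℝ) ^ 3
        / (-512 : ℝ) ^ k)
      (Real.sqrt 2 / (24 * Real.pi)) ∧
    HasSum (fun k : ℕ =>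
      (83592 * (k : ℝ) ^ 2 + 152922 * (k : ℝ) + 64925) * ((2 * k).choose (k + 1) : ℝ) ^ 3
        / (-512 : ℝ) ^ k)
      (625282 * (Real.sqrt 2 / Real.pi) - 281920) ∧
    HasSum (fun k : ℕ =>
      (198 * (k : ℝ) ^ 2 - 425 * (k : ℝ) + 210) * (k : ℝ) ^ 3 * ((2 * k).choose k : ℝ) ^ 3
        / (4096 : ℝ) ^ k)
      (-(1 / (21 * Real.pi))) ∧
    HasSum (fun k : ℕ =>
      (32473224 * (k : ℝ) ^ 2 + 58012446 * (k : ℝ) + 24235261)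
        * ((2 * k).choose (k + 1) : ℝ) ^ 3 / (4096 : ℝ) ^ k)
      (667628032 - 2097324016 / Real.pi) := by
  have hπ := Real.pi_ne_zero
  refine ⟨?_, ?_, ?_, ?_, ?_, ?_⟩
  -- Here X³ divides q: then (x+1)³ cancels in the identity, and q(0) = 0 leaves no rational part.
  · refine hasSum_choose_cube (z := 1 / 4) (α := -1 / 48) (by norm_num [abs_div]) (by norm_num)
      (fun x => (6 * x ^ 2 - 19 * x + 6) * x ^ 3)
      (- C (22 / 3) * X ^ 3 + 16 * X ^ 4 - 8 * X ^ 5) hasSum_ramanujan_four (fun x => ?_) ?_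
    · simp
      ring
    · simp
      field_simp
      ring
  -- Now q is quadratic; it and α are chosen so that the right side is divisible by x³, and -q(0) is
  -- the rational part of the sum.
  · refine hasSum_choose_succ_cube (z := 1 / 4) (α := -21151) (by norm_num [abs_div]) (by norm_num)
      (fun x => 13608 * x ^ 2 + 25050 * x + 10589)
      (- 27296 - 151200 * X - 18144 * X ^ 2) hasSum_ramanujan_four (fun x => ?_) ?_
    · simp
      ring
    · simp
      field_simp
      ring
  · refine hasSum_choose_cube (z := -1 / 8) (α := 1 / 48) (by norm_num [abs_div]) (by norm_num)
      (fun x => (18 * x ^ 2 - 29 * x + 16) * x ^ 3)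
      (- C (44 / 3) * X ^ 3 + 32 * X ^ 4 - 16 * X ^ 5) hasSum_ramanujan_eight (fun x => ?_) ?_
    · simp
      ring
    · simp
      field_simp
      ring
  · refine hasSum_choose_succ_cube (z := -1 / 8) (α := 312641) (by norm_num [abs_div]) (by norm_num)
      (fun x => 83592 * x ^ 2 + 152922 * x + 64925)
      (281920 + 1758528 * X - 74304 * X ^ 2) hasSum_ramanujan_eight (fun x => ?_) ?_
    · simp
      ring
    · simp
      field_simp
      ring
  · refine hasSum_choose_cube (z := 1 / 64) (α := -1 / 336) (by norm_num [abs_div]) (by norm_num)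
      (fun x => (198 * x ^ 2 - 425 * x + 210) * x ^ 3)
      (- C (4448 / 21) * X ^ 3 + C (2944 / 7) * X ^ 4 - C (1408 / 7) * X ^ 5) hasSum_ramanujan_sixtyFour (fun x => ?_) ?_
    · simp
      ring
    · simp
      field_simp
      ring
  · refine hasSum_choose_succ_cube (z := 1 / 64) (α := -131082751) (by norm_num [abs_div]) (by norm_num)
      (fun x => 32473224 * x ^ 2 + 58012446 * x + 24235261)
      (- 667628032 - 5553093120 * X - 32988672 * X ^ 2) hasSum_ramanujan_sixtyFour (fun x => ?_) ?_
    · simp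
      ring
    · simp
      field_simp
      ring
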